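/- Let $X,Y$ be Polish spaces and let $c:X\times Y\to[0,\infty)$ be a (finitely valued) continuous cost function. For Borel probability measures $\alpha$ on $X$ and $\beta$ on $Y$ let $\Pi(\alpha,\beta)$ be the set of Borel probability measures on $X\times Y$ with marginals $\alpha$ and $\beta$, put $I(\pi)=\int_{X\times Y}c\,d\pi\in[0,\infty]$, and call $\pi\in\Pi(\alpha,\beta)$ an optimizer for $(\alpha,\beta,c)$ if $I(\pi)\le I(\pi')$ for all $\pi'\in\Pi(\alpha,\beta)$ (the minimal cost may be $+\infty$). Let $(\mu_n)$ and $(\nu_n)$ be sequences of Borel probability measures on $X$ and $Y$ that converge weakly to Borel probability measures $\mu$ and $\nu$, and for each $n$ let $\pi_n$ be an optimizer for $(\mu_n,\nu_n,c)$ with $I(\pi_n)<\infty$. Then: 1. there is a subsequence $(\pi_{n_k})$ that converges weakly to a transport plan $\pi\in\Pi(\mu,\nu)$ which is an optimizer for $(\mu,\nu,c)$; 2. the weak limit of every weakly convergent subsequence of $(\pi_n)$ is an optimizer for $(\mu,\nu,c)$; 3. the set of adherence points of $(\pi_n)$ in the weak topology on the Borel probability measures on $X\times Y$ is non-empty and consists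 of optimizers for $(\mu,\nu,c)$. -/

import Mathlib

open MeasureTheory Filter Topology
open scoped ENNReal NNReal

/-- The transport plans `Π(μ, ν)`: Borel probability measures on `X × Y` with first marginal `μ`
and second marginal `ν`. -/
def transportPlans {X Y : Type*} [MeasurableSpace X] [MeasurableSpace Y]
    (μ : ProbabilityMeasure X) (ν : ProbabilityMeasure Y) : Set (ProbabilityMeasure (X × Y)) :=
  {π | (π : Measure (X × Y)).fst = (μ : Measure X) ∧ (π : Measure (X × Y)).snd = (ν : Measure Y)}

/-- The cost `I(π) = ∫ c(x, y) π(dx, dy)`, with values in `[0, ∞]`. -/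
noncomputable def transportCost {X Y : Type*} [MeasurableSpace X] [MeasurableSpace Y]
    (c : X × Y → ℝ≥0∞) (π : ProbabilityMeasure (X × Y)) : ℝ≥0∞ :=
  ∫⁻ p, c p ∂(π : Measure (X × Y))

/-- `π` is an optimizer (a solution) of the Monge-Kantorovich problem `(μ, ν, c)`: a transport plan
that minimizes the cost among all transport plans. The minimal cost may be `∞`. -/
def IsOptimalPlan {X Y : Type*} [MeasurableSpace X] [MeasurableSpace Y]
    (μ : ProbabilityMeasure X) (ν : ProbabilityMeasure Y) (c : X × Y → ℝ≥0∞)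
    (π : ProbabilityMeasure (X × Y)) : Prop :=
  π ∈ transportPlans μ ν ∧ ∀ π' ∈ transportPlans μ ν, transportCost c π ≤ transportCost c π'

/-- `(π n)` is an approximating sequence of optimizers: `μs n → μ` and `νs n → ν` weakly, and each
`π n` is an optimizer of finite cost for `(μs n, νs n, c)`. -/
structure IsApproximatingSequence {X Y : Type*}
    [TopologicalSpace X] [MeasurableSpace X] [OpensMeasurableSpace X]
    [TopologicalSpace Y] [MeasurableSpace Y] [OpensMeasurableSpace Y]
    (μ : ProbabilityMeasure X) (ν : ProbabilityMeasure Y) (c : X × Y → ℝ≥0∞)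
    (μs : ℕ → ProbabilityMeasure X) (νs : ℕ → ProbabilityMeasure Y)
    (πs : ℕ → ProbabilityMeasure (X × Y)) : Prop where
  tendsto_fst : Tendsto μs atTop (𝓝 μ)
  tendsto_snd : Tendsto νs atTop (𝓝 ν)
  optimal : ∀ n, IsOptimalPlan (μs n) (νs n) c (πs n)
  cost_lt_top : ∀ n, transportCost c (πs n) < ∞

/-!
Lower semicontinuity bounds the cost of a weak limit `π` of optimal plans `π n` by the lower limit
of their costs, but the latter may be infinite, or larger than the optimal cost of the limit
problem. So optimality is passed to the limit through the geometry of the supports instead.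

An optimal plan of finite cost cannot charge each of finitely many sets `U i` such that a permutation
of the first coordinates lowers the total cost of every tuple of points `w i ∈ U i`
(`IsOptimalPlan.exists_measure_eq_zero`). As strict inequalities between values of `c` persist on
open sets, the support of a weak limit is `c`-cyclically monotone
(`IsOptimalPlan.isCyclicallyMonotone_support_of_tendsto`).

Conversely, a plan `π` with cyclically monotone support is optimal, whether or not its cost is
finite. As `c` is finite and continuous, Rockafellar's chain construction gives Borel functions `φ`
and `ψ` with `φ x + ψ y ≤ c (x, y)` and with equality on the support
(`IsCyclicallyMonotone.exists_potentials`). These need not be integrable, but their truncations are;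
comparing the truncated integrals for `π` and for a competitor `π'` and applying Fatou's lemma to
the former yields `I(π) ≤ I(π')` (`transportCost_le_of_potentials`).

Existence of limits comes from Prokhorov's theorem: the marginals form tight families, and hence so
do the plans (`exists_subseq_tendsto_of_tendsto_marginals`).
-/

/-! ### Rerouting a part of an optimal plan -/

/-- Replacing a part `θ` of an optimal plan of finite cost by a measure `θ'` with the same marginals
does not lower the cost: the competitor is `π - θ + θ'`. -/
theorem IsOptimalPlan.lintegral_le_of_le {X Y : Type*} [MeasurableSpace X] [MeasurableSpace Y]
    {μ : ProbabilityMeasure X} {ν : ProbabilityMeasure Y} {c : X × Y → ℝ≥0∞}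
    {π : ProbabilityMeasure (X × Y)} (hπ : IsOptimalPlan μ ν c π) (hfin : transportCost c π < ∞)
    {θ θ' : Measure (X × Y)} (hθ : θ ≤ (π : Measure (X × Y)))
    (hfst : θ'.fst = θ.fst) (hsnd : θ'.snd = θ.snd) :
    ∫⁻ p, c p ∂θ ≤ ∫⁻ p, c p ∂θ' := by
  have : IsFiniteMeasure θ := isFiniteMeasure_of_le _ hθ
  obtain ⟨⟨hμ, hν⟩, hmin⟩ := hπ
  set ρ : Measure (X × Y) := (π : Measure (X × Y)) - θ with hρ
  have hadd : ρ + θ = (π : Measure (X × Y)) := Measure.sub_add_cancel_of_le hθ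
  have h1 : (ρ + θ').fst = (μ : Measure X) := by
    rw [← hμ, ← hadd, Measure.fst_add, Measure.fst_add, hfst]
  have h2 : (ρ + θ').snd = (ν : Measure Y) := by
    rw [← hν, ← hadd, Measure.snd_add, Measure.snd_add, hsnd]
  have hprob : IsProbabilityMeasure (ρ + θ') :=
    ⟨by rw [← Measure.fst_univ, h1]; exact measure_univ⟩
  have hle := hmin ⟨ρ + θ', hprob⟩ ⟨h1, h2⟩
  have hρfin : ∫⁻ p, c p ∂ρ ≠ ∞ :=
    ((lintegral_mono' Measure.sub_le le_rfl).trans_lt hfin).ne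
  simp only [transportCost, ProbabilityMeasure.coe_mk, lintegral_add_measure] at hle
  rw [← hadd, lintegral_add_measure] at hle
  exact (ENNReal.add_le_add_iff_left hρfin).1 hle

/-- If permuting the first coordinates lowers the total cost of every `n`-tuple of points
`w i ∈ U i`, then an optimal plan of finite cost charges at most `n - 1` of the sets `U i`: otherwise
a small multiple of it could be rerouted inside the `U i` at a strictly smaller cost. -/
theorem IsOptimalPlan.exists_measure_eq_zero {X Y : Type*} [MeasurableSpace X] [MeasurableSpace Y]
    {μ : ProbabilityMeasure X} {ν : ProbabilityMeasure Y} {c : X × Y → ℝ≥0∞} (hc : Measurable c)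
    {π : ProbabilityMeasure (X × Y)} (hπ : IsOptimalPlan μ ν c π) (hfin : transportCost c π < ∞)
    {n : ℕ} (σ : Equiv.Perm (Fin n)) {U : Fin n → Set (X × Y)} (hU : ∀ i, MeasurableSet (U i))
    (hlt : ∀ w : Fin n → X × Y, (∀ i, w i ∈ U i) →
      ∑ i, c ((w (σ i)).1, (w i).2) < ∑ i, c (w i)) :
    ∃ i, (π : Measure (X × Y)) (U i) = 0 := by
  by_contra! hpos
  -- `Q` samples one point from each `U i` independently. The averaged law `θ` of its coordinates is
  -- part of `π`, and `θ'` is the averaged law after the first coordinates have been permuted.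
  set Q : Measure (Fin n → X × Y) :=
    Measure.pi fun i => (π : Measure (X × Y)).restrict (U i) with hQ
  set a : ℝ≥0∞ := (n : ℝ≥0∞)⁻¹ with ha
  set θ : Measure (X × Y) := a • ∑ i, Q.map (fun w => w i) with hθ
  set θ' : Measure (X × Y) := a • ∑ i, Q.map (fun w => ((w (σ i)).1, (w i).2)) with hθ'
  have hn : n ≠ 0 := by
    rintro rfl
    simpa using hlt Fin.elim0 (fun i => i.elim0)
  have ha0 : a ≠ 0 := by simp [ha]
  have hat : a ≠ ∞ := by simp [ha, hn]
  have hswap : ∀ i, Measurable fun w : Fin n → X × Y => ((w (σ i)).1, (w i).2) :=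
    fun i => by fun_prop
  have hmarg : ∀ i, Q.map (fun w => w i) ≤ (π : Measure (X × Y)) := by
    intro i
    have h1 := Measure.pi_map_eval (fun i => (π : Measure (X × Y)).restrict (U i)) i
    change Q.map (fun w => w i) = _ at h1
    rw [h1]
    refine le_trans ?_ (Measure.restrict_le_self (s := U i))
    refine Measure.le_iff.2 fun s _ => ?_
    rw [Measure.smul_apply, smul_eq_mul]
    refine mul_le_of_le_one_left zero_le (Finset.prod_le_one' fun j _ => ?_)
    rw [Measure.restrict_apply_univ]
    exact prob_le_one
  have hθle : θ ≤ (π : Measure (X × Y)) := by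
    refine Measure.le_iff.2 fun s _ => ?_
    rw [hθ, Measure.smul_apply, Measure.finsetSum_apply, smul_eq_mul]
    calc a * ∑ i, (Q.map fun w => w i) s
        ≤ a * ∑ _i : Fin n, (π : Measure (X × Y)) s := by
          gcongr with i
          exact hmarg i
      _ = (π : Measure (X × Y)) s := by
          rw [Finset.sum_const, Finset.card_univ, Fintype.card_fin, nsmul_eq_mul, ← mul_assoc,
            ENNReal.inv_mul_cancel (by simpa using hn) (by simp), one_mul]
  have hfst : θ'.fst = θ.fst := by
    ext s hs
    simp only [hθ, hθ', Measure.fst_apply hs, Measure.smul_apply, Measure.finsetSum_apply]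
    congr 1
    refine Eq.trans (Finset.sum_congr rfl fun i _ => ?_)
      (Equiv.sum_comp σ fun i => (Q.map fun w => w i) (Prod.fst ⁻¹' s))
    rw [Measure.map_apply (hswap i) (measurable_fst hs),
      Measure.map_apply (by fun_prop) (measurable_fst hs)]
    rfl
  have hsnd : θ'.snd = θ.snd := by
    ext s hs
    simp only [hθ, hθ', Measure.snd_apply hs, Measure.smul_apply, Measure.finsetSum_apply]
    congr 1
    refine Finset.sum_congr rfl fun i _ => ?_
    rw [Measure.map_apply (hswap i) (measurable_snd hs),
      Measure.map_apply (by fun_prop) (measurable_snd hs)]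
    rfl
  have hle := hπ.lintegral_le_of_le hfin hθle hfst hsnd
  have hint : ∫⁻ p, c p ∂θ = a * ∫⁻ w, ∑ i, c (w i) ∂Q := by
    rw [hθ, lintegral_smul_measure, lintegral_finsetSum_measure,
      lintegral_finsetSum _ (fun i _ => by fun_prop), smul_eq_mul]
    congr 1
    exact Finset.sum_congr rfl fun i _ => lintegral_map hc (by fun_prop)
  have hint' : ∫⁻ p, c p ∂θ' = a * ∫⁻ w, ∑ i, c ((w (σ i)).1, (w i).2) ∂Q := by
    rw [hθ', lintegral_smul_measure, lintegral_finsetSum_measure,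
      lintegral_finsetSum _ (fun i _ => by fun_prop), smul_eq_mul]
    congr 1
    exact Finset.sum_congr rfl fun i _ => lintegral_map hc (hswap i)
  have hθfin : ∫⁻ p, c p ∂θ ≠ ∞ := ((lintegral_mono' hθle le_rfl).trans_lt hfin).ne
  rw [hint, hint', ENNReal.mul_le_mul_iff_right ha0 hat] at hle
  refine absurd hle (not_le.2 ?_)
  have hQ0 : Q ≠ 0 := by
    rw [← Measure.measure_univ_ne_zero, hQ, Measure.pi_univ]
    simpa [Finset.prod_eq_zero_iff] using hpos
  have hae : ∀ᵐ w ∂Q, ∀ i, w i ∈ U i := by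
    refine ae_all_iff.2 fun i => ?_
    exact Measure.tendsto_eval_ae_ae.eventually (ae_restrict_mem (hU i))
  have hfinQ : ∫⁻ w, ∑ i, c (w i) ∂Q ≠ ∞ := by
    intro htop
    rw [hint, htop, ENNReal.mul_top ha0] at hθfin
    exact hθfin rfl
  refine lintegral_strict_mono hQ0
    (Finset.measurable_fun_sum _ fun i _ => hc.comp (measurable_pi_apply i)).aemeasurable ?_
    (hae.mono fun w hw => hlt w hw)
  exact ne_top_of_le_ne_top hfinQ (lintegral_mono_ae (hae.mono fun w hw => (hlt w hw).le))

/-! ### Cyclically monotone sets and potentials -/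

/-- `Γ` is `c`-cyclically monotone: no permutation of the first coordinates of finitely many points
of `Γ` (repetitions allowed) lowers their total cost. Arbitrary permutations are admitted here, not
only cyclic ones; the two conditions are equivalent, and this one needs no indices modulo `n`. -/
def IsCyclicallyMonotone {X Y : Type*} (c : X × Y → ℝ≥0) (Γ : Set (X × Y)) : Prop :=
  ∀ (n : ℕ) (σ : Equiv.Perm (Fin n)) (w : Fin n → X × Y), (∀ i, w i ∈ Γ) →
    ∑ i, c (w i) ≤ ∑ i, c ((w (σ i)).1, (w i).2)

/-- The cost of moving along the chain `p 0, …, p n` and then on to `x`, that is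
`∑_{i < n} (c(x_{i+1}, y_i) - c(x_i, y_i)) + c(x, y_n) - c(x_n, y_n)` where `p i = (x_i, y_i)`.
The terms of `p` beyond `p n` play no role. -/
def chainCost {X Y : Type*} (c : X × Y → ℝ≥0) (p : ℕ → X × Y) (n : ℕ) (x : X) : ℝ :=
  ∑ i ∈ Finset.range n, ((c ((p (i + 1)).1, (p i).2) : ℝ) - c (p i)) +
    ((c (x, (p n).2) : ℝ) - c (p n))

theorem continuous_chainCost {X Y : Type*} [TopologicalSpace X] [TopologicalSpace Y]
    {c : X × Y → ℝ≥0} (hc : Continuous c) (p : ℕ → X × Y) (n : ℕ) :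
    Continuous (chainCost c p n) := by
  unfold chainCost
  fun_prop

theorem chainCost_update_succ {X Y : Type*} (c : X × Y → ℝ≥0) (p : ℕ → X × Y) (n : ℕ)
    (q : X × Y) (x : X) :
    chainCost c (Function.update p (n + 1) q) (n + 1) x =
      chainCost c p n q.1 + ((c (x, q.2) : ℝ) - c q) := by
  have hlt : ∀ i ∈ Finset.range n,
      ((c ((Function.update p (n + 1) q (i + 1)).1, (Function.update p (n + 1) q i).2) : ℝ) -
        c (Function.update p (n + 1) q i)) = (c ((p (i + 1)).1, (p i).2) : ℝ) - c (p i) := by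
    intro i hi
    have := Finset.mem_range.1 hi
    rw [Function.update_of_ne (by lia), Function.update_of_ne (by lia)]
  rw [chainCost, Finset.sum_range_succ, Finset.sum_congr rfl hlt, chainCost,
    Function.update_self, Function.update_of_ne (by lia)]

theorem IsCyclicallyMonotone.chainCost_nonneg {X Y : Type*} {c : X × Y → ℝ≥0} {Γ : Set (X × Y)}
    (hΓ : IsCyclicallyMonotone c Γ) {p : ℕ → X × Y} (hp : ∀ i, p i ∈ Γ) (n : ℕ) :
    0 ≤ chainCost c p n (p 0).1 := by
  -- Closing the chain at its starting point gives an `(n + 1)`-cycle.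
  have h := hΓ (n + 1) (finRotate (n + 1)) (fun i => p i) (fun i => hp i)
  rw [Fin.sum_univ_castSucc, Fin.sum_univ_castSucc] at h
  simp only [Fin.val_castSucc, Fin.val_last, Fin.val_zero, Fin.coeSucc_eq_succ, finRotate_apply,
    Fin.val_succ, Fin.last_add_one] at h
  rw [Fin.sum_univ_eq_sum_range (fun i => c (p i)),
    Fin.sum_univ_eq_sum_range (fun i => c ((p (i + 1)).1, (p i).2))] at h
  have h' : ((∑ i ∈ Finset.range n, c (p i) + c (p n) : ℝ≥0) : ℝ) ≤
    ((∑ i ∈ Finset.range n, c ((p (i + 1)).1, (p i).2) + c ((p 0).1, (p n).2) : ℝ≥0) : ℝ) := h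
  push_cast at h'
  rw [chainCost, Finset.sum_sub_distrib]
  linarith

/-- Rockafellar's construction: a nonempty cyclically monotone set is contained in the contact set
of a pair of potentials. For fixed `p₀ ∈ Γ`, the potential `φ x` is the infimum of the costs of the
chains in `Γ` from `p₀` to `x`, and `ψ y = ⨅ x, c (x, y) - φ x`. Both are infima of continuous
functions, hence upper semicontinuous, hence Borel. The value `φ x = -∞` may occur for `x` outside
the projection of `Γ`. -/
theorem IsCyclicallyMonotone.exists_potentials {X Y : Type*}
    [TopologicalSpace X] [MeasurableSpace X] [OpensMeasurableSpace X]
    [TopologicalSpace Y] [MeasurableSpace Y] [OpensMeasurableSpace Y]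
    {c : X × Y → ℝ≥0} (hc : Continuous c) {Γ : Set (X × Y)}
    (hΓ : IsCyclicallyMonotone c Γ) (hne : Γ.Nonempty) :
    ∃ (φ : X → EReal) (ψ : Y → EReal), Measurable φ ∧ Measurable ψ ∧
      (∀ x y, φ x + ψ y ≤ ((c (x, y) : ℝ) : EReal)) ∧
      ∀ q ∈ Γ, φ q.1 + ψ q.2 = ((c q : ℝ) : EReal) := by
  obtain ⟨p₀, hp₀⟩ := hne
  let P := {p : ℕ → X × Y // (∀ i, p i ∈ Γ) ∧ p 0 = p₀}
  let φ : X → EReal := fun x => ⨅ (p : P) (n : ℕ), (chainCost c p.1 n x : EReal)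
  let ψ : Y → EReal := fun y => ⨅ x : X, (((c (x, y) : ℝ) : EReal) - φ x)
  -- A chain ending at `q.1` can be prolonged by the point `q` of `Γ`.
  have hstep : ∀ q ∈ Γ, ∀ x, φ x ≤ φ q.1 + (((c (x, q.2) : ℝ) - c q : ℝ) : EReal) := by
    intro q hq x
    rw [← EReal.sub_le_iff_le_add (.inl (EReal.coe_ne_bot _)) (.inl (EReal.coe_ne_top _))]
    refine le_iInf₂ fun p n => ?_
    rw [EReal.sub_le_iff_le_add (.inl (EReal.coe_ne_bot _)) (.inl (EReal.coe_ne_top _)),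
      ← EReal.coe_add, ← chainCost_update_succ]
    refine iInf₂_le_of_le ⟨Function.update p.1 (n + 1) q, fun i => ?_, ?_⟩ (n + 1) le_rfl
    · rcases eq_or_ne i (n + 1) with rfl | hi
      · simpa using hq
      · simpa [hi] using p.2.1 i
    · simpa using p.2.2
  -- Together with `hstep`, this bounds `φ` from below on the projection of `Γ`.
  have hφ0 : 0 ≤ φ p₀.1 := by
    refine le_iInf₂ fun p n => ?_
    have h := hΓ.chainCost_nonneg p.2.1 n
    rw [p.2.2] at h
    exact_mod_cast h
  have hbot : ∀ q ∈ Γ, φ q.1 ≠ ⊥ := by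
    intro q hq hb
    have := hφ0.trans (hstep q hq p₀.1)
    simp [hb] at this
  have htop : ∀ x, φ x ≠ ⊤ := by
    intro x
    refine ne_top_of_le_ne_top (EReal.coe_ne_top (chainCost c (fun _ => p₀) 0 x)) ?_
    exact iInf₂_le (⟨fun _ => p₀, fun _ => hp₀, rfl⟩ : P) 0
  refine ⟨φ, ψ, ?_, ?_, ?_, ?_⟩
  · refine UpperSemicontinuous.measurable (upperSemicontinuous_iInf fun p =>
      upperSemicontinuous_iInf fun n => Continuous.upperSemicontinuous ?_)
    exact continuous_coe_real_ereal.comp (continuous_chainCost hc p.1 n)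
  · refine UpperSemicontinuous.measurable (upperSemicontinuous_iInf fun x =>
      Continuous.upperSemicontinuous ?_)
    induction hx : φ x with
    | bot => simpa using continuous_const
    | top => exact absurd hx (htop x)
    | coe r =>
      simp only [← EReal.coe_sub]
      exact continuous_coe_real_ereal.comp (by fun_prop)
  · intro x y
    have h1 : ψ y ≤ ((c (x, y) : ℝ) : EReal) - φ x := iInf_le _ x
    rw [add_comm]
    exact EReal.add_le_of_le_sub h1
  · rintro q hq
    refine le_antisymm ?_ ?_
    · have h1 : ψ q.2 ≤ ((c q : ℝ) : EReal) - φ q.1 := iInf_le _ q.1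
      rw [add_comm]
      exact EReal.add_le_of_le_sub h1
    · obtain ⟨r, hr⟩ : ∃ r : ℝ, φ q.1 = r :=
        ⟨_, (EReal.coe_toReal (htop q.1) (hbot q hq)).symm⟩
      have h1 : (((c q : ℝ) - r : ℝ) : EReal) ≤ ψ q.2 := by
        refine le_iInf fun x => ?_
        have h2 := hstep q hq x
        rw [hr] at h2
        induction hx : φ x with
        | bot => simp
        | top => exact absurd hx (htop x)
        | coe s =>
          rw [hx] at h2
          norm_cast at h2 ⊢
          linarith
      calc ((c q : ℝ) : EReal) = (r : EReal) + (((c q : ℝ) - r : ℝ) : EReal) := by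
            norm_cast
            ring
        _ ≤ φ q.1 + ψ q.2 := by
            rw [hr]
            gcongr

/-! ### Optimality from potentials -/

/-- The truncation of an extended real number to the interval `[-n, n]`, as a real number. -/
noncomputable def truncate (n : ℕ) (a : EReal) : ℝ :=
  (max (((-n : ℝ)) : EReal) (min a ((n : ℝ) : EReal))).toReal

theorem measurable_truncate (n : ℕ) : Measurable (truncate n) :=
  (measurable_const.max (measurable_id.min measurable_const)).ereal_toReal

@[simp]
theorem truncate_top (n : ℕ) : truncate n ⊤ = n := by
  have : ((-n : ℝ) : EReal) ≤ ((n : ℝ) : EReal) := by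
    exact_mod_cast neg_le_self (Nat.cast_nonneg (α := ℝ) n)
  rw [truncate, top_inf_eq, max_eq_right this, EReal.toReal_coe]

@[simp]
theorem truncate_bot (n : ℕ) : truncate n ⊥ = -n := by
  rw [truncate, bot_inf_eq, sup_bot_eq, EReal.toReal_coe]

@[simp]
theorem truncate_coe (n : ℕ) (r : ℝ) : truncate n (r : EReal) = max (-n : ℝ) (min r n) := by
  rw [truncate, ← EReal.coe_strictMono.monotone.map_min,
    ← EReal.coe_strictMono.monotone.map_max, EReal.toReal_coe]

theorem abs_truncate_le (n : ℕ) (a : EReal) : |truncate n a| ≤ n := by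
  have h0 : (0 : ℝ) ≤ n := Nat.cast_nonneg n
  induction a with
  | bot => simp
  | top => simp
  | coe r =>
    rw [truncate_coe, abs_le]
    exact ⟨le_max_left _ _, max_le (by linarith) (min_le_right _ _)⟩

/-- Truncation preserves upper bounds `t ≥ 0` of a sum: if `a > n` the truncated sum is below
`a + b` or nonpositive, and likewise for `b`. -/
theorem truncate_add_truncate_le (n : ℕ) {a b : EReal} {t : ℝ} (ht : 0 ≤ t)
    (h : a + b ≤ (t : EReal)) : truncate n a + truncate n b ≤ t := by
  have ha := abs_le.1 (abs_truncate_le n a)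
  have hb := abs_le.1 (abs_truncate_le n b)
  induction a with
  | bot => rw [truncate_bot]; linarith
  | top =>
    induction b with
    | bot => simpa using ht
    | top => simp at h
    | coe s => simp at h
  | coe r =>
    induction b with
    | bot => rw [truncate_bot]; linarith
    | top => simp at h
    | coe s =>
      norm_cast at h
      rw [truncate_coe, truncate_coe]
      rcases max_cases (-n : ℝ) (min r n) with h1 | h1 <;>
      rcases max_cases (-n : ℝ) (min s n) with h2 | h2 <;>
      linarith [min_le_left r (n : ℝ), min_le_left s (n : ℝ), min_le_right r (n : ℝ),
        min_le_right s (n : ℝ)]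

theorem truncate_add_truncate_nonneg (n : ℕ) {r s : ℝ} (h : 0 ≤ r + s) :
    0 ≤ truncate n (r : EReal) + truncate n (s : EReal) := by
  have h0 : (0 : ℝ) ≤ n := Nat.cast_nonneg n
  rw [truncate_coe, truncate_coe]
  rcases min_cases r (n : ℝ) with h1 | h1 <;> rcases min_cases s (n : ℝ) with h2 | h2 <;>
  linarith [le_max_left (-n : ℝ) (min r n), le_max_left (-n : ℝ) (min s n),
    le_max_right (-n : ℝ) (min r n), le_max_right (-n : ℝ) (min s n)]

theorem eventually_truncate_eq (r : ℝ) : ∀ᶠ n : ℕ in atTop, truncate n (r : EReal) = r := by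
  filter_upwards [eventually_ge_atTop ⌈|r|⌉₊] with n hn
  have h := abs_le.1 (Nat.ceil_le.1 hn)
  rw [truncate_coe, min_eq_left h.2, max_eq_right h.1]

/-- A plan concentrated on the contact set of two potentials is optimal. Neither the integrability
of the potentials nor the finiteness of either cost is needed: the truncated potentials are bounded,
so their sums have the same integral against `π` and `π'`; these sums lie below `c`, and on the
contact set they are nonnegative and converge to `c`, so that Fatou's lemma applies. -/
theorem transportCost_le_of_potentials {X Y : Type*} [MeasurableSpace X] [MeasurableSpace Y]
    {μ : ProbabilityMeasure X} {ν : ProbabilityMeasure Y} {c : X × Y → ℝ≥0}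
    {φ : X → EReal} {ψ : Y → EReal} (hφ : Measurable φ) (hψ : Measurable ψ)
    (hle : ∀ x y, φ x + ψ y ≤ ((c (x, y) : ℝ) : EReal))
    {π π' : ProbabilityMeasure (X × Y)} (hπ : π ∈ transportPlans μ ν)
    (hπ' : π' ∈ transportPlans μ ν)
    (heq : ∀ᵐ p ∂(π : Measure (X × Y)), φ p.1 + ψ p.2 = ((c p : ℝ) : EReal)) :
    transportCost (fun p => (c p : ℝ≥0∞)) π ≤ transportCost (fun p => (c p : ℝ≥0∞)) π' := by
  set f : ℕ → X × Y → ℝ := fun n p => truncate n (φ p.1) + truncate n (ψ p.2) with hf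
  have hu : ∀ n, Measurable fun x => truncate n (φ x) := fun n => (measurable_truncate n).comp hφ
  have hv : ∀ n, Measurable fun y => truncate n (ψ y) := fun n => (measurable_truncate n).comp hψ
  have hfm : ∀ n, Measurable (f n) := fun n =>
    ((hu n).comp measurable_fst).add ((hv n).comp measurable_snd)
  have hbound : ∀ (ρ : ProbabilityMeasure (X × Y)) (n : ℕ),
      Integrable (fun p : X × Y => truncate n (φ p.1)) (ρ : Measure (X × Y)) ∧
      Integrable (fun p : X × Y => truncate n (ψ p.2)) (ρ : Measure (X × Y)) := fun ρ n =>
    ⟨.of_bound ((hu n).comp measurable_fst).aestronglyMeasurable n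
      (.of_forall fun p => abs_truncate_le n _),
     .of_bound ((hv n).comp measurable_snd).aestronglyMeasurable n
      (.of_forall fun p => abs_truncate_le n _)⟩
  have hint : ∀ (ρ : ProbabilityMeasure (X × Y)) (n : ℕ), Integrable (f n) (ρ : Measure (X × Y)) :=
    fun ρ n => (hbound ρ n).1.add (hbound ρ n).2
  -- The integral of `f n` depends on the marginals only.
  have hval : ∀ ρ ∈ transportPlans μ ν, ∀ n, ∫ p, f n p ∂(ρ : Measure (X × Y)) =
      ∫ x, truncate n (φ x) ∂(μ : Measure X) + ∫ y, truncate n (ψ y) ∂(ν : Measure Y) := by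
    rintro ρ ⟨h1, h2⟩ n
    rw [← h1, ← h2, Measure.fst, Measure.snd,
      integral_map measurable_fst.aemeasurable (hu n).aestronglyMeasurable,
      integral_map measurable_snd.aemeasurable (hv n).aestronglyMeasurable]
    exact integral_add (hbound ρ n).1 (hbound ρ n).2
  have hreal : ∀ p : X × Y, φ p.1 + ψ p.2 = ((c p : ℝ) : EReal) →
      ∃ r s : ℝ, φ p.1 = r ∧ ψ p.2 = s ∧ r + s = c p := by
    intro p hp
    induction h1 : φ p.1 with
    | bot => simp [h1] at hp
    | top => induction h2 : ψ p.2 with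
      | bot => simp [h1, h2] at hp
      | top => simp [h1, h2] at hp
      | coe s => simp [h1, h2] at hp
    | coe r => induction h2 : ψ p.2 with
      | bot => simp [h1, h2] at hp
      | top => simp [h1, h2] at hp
      | coe s =>
        rw [h1, h2] at hp
        exact ⟨r, s, rfl, rfl, by exact_mod_cast hp⟩
  have hnonneg : ∀ n, 0 ≤ᵐ[(π : Measure (X × Y))] f n := by
    intro n
    filter_upwards [heq] with p hp
    obtain ⟨r, s, h1, h2, h3⟩ := hreal p hp
    simp only [hf, h1, h2]
    exact truncate_add_truncate_nonneg n (h3 ▸ (c p).2)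
  have hstep : ∀ n, ∫⁻ p, ENNReal.ofReal (f n p) ∂(π : Measure (X × Y)) ≤
      transportCost (fun p => (c p : ℝ≥0∞)) π' := by
    intro n
    rw [← ofReal_integral_eq_lintegral_ofReal (hint π n) (hnonneg n), hval π hπ, ← hval π' hπ']
    have hpos : ENNReal.ofReal (∫ p, f n p ∂(π' : Measure (X × Y))) ≤
        ∫⁻ p, ENNReal.ofReal (f n p) ∂(π' : Measure (X × Y)) := by
      refine ENNReal.ofReal_le_of_le_toReal ?_
      rw [integral_eq_lintegral_pos_part_sub_lintegral_neg_part (hint π' n)]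
      exact sub_le_self _ ENNReal.toReal_nonneg
    refine hpos.trans (lintegral_mono fun p => ?_)
    rw [← ENNReal.ofReal_coe_nnreal]
    exact ENNReal.ofReal_le_ofReal (truncate_add_truncate_le n (c p).2 (hle p.1 p.2))
  calc transportCost (fun p => (c p : ℝ≥0∞)) π
      = ∫⁻ p, liminf (fun n => ENNReal.ofReal (f n p)) atTop ∂(π : Measure (X × Y)) := by
        refine lintegral_congr_ae ?_
        filter_upwards [heq] with p hp
        obtain ⟨r, s, h1, h2, h3⟩ := hreal p hp
        refine (Tendsto.liminf_eq (tendsto_const_nhds.congr' ?_)).symm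
        filter_upwards [eventually_truncate_eq r, eventually_truncate_eq s] with n hr hs
        simp only [hf, h1, h2, hr, hs, h3, ENNReal.ofReal_coe_nnreal]
    _ ≤ liminf (fun n => ∫⁻ p, ENNReal.ofReal (f n p) ∂(π : Measure (X × Y))) atTop :=
        lintegral_liminf_le fun n => (hfm n).ennreal_ofReal
    _ ≤ liminf (fun _ : ℕ => transportCost (fun p => (c p : ℝ≥0∞)) π') atTop :=
        liminf_le_liminf (.of_forall hstep)
    _ = transportCost (fun p => (c p : ℝ≥0∞)) π' := liminf_const _

/-! ### Weak limits of optimal plans -/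

/-- The support of a weak limit of optimal plans of finite cost is cyclically monotone, even if the
limit has infinite cost: strict failure of monotonicity at points of the support persists on open
neighbourhoods, and by the portmanteau theorem some plan of the sequence charges all of them. -/
theorem IsOptimalPlan.isCyclicallyMonotone_support_of_tendsto {X Y ι : Type*}
    [TopologicalSpace X] [PolishSpace X] [MeasurableSpace X] [BorelSpace X]
    [TopologicalSpace Y] [PolishSpace Y] [MeasurableSpace Y] [BorelSpace Y]
    {c : X × Y → ℝ≥0} (hc : Continuous c) {l : Filter ι} [l.NeBot]
    {μs : ι → ProbabilityMeasure X} {νs : ι → ProbabilityMeasure Y}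
    {πs : ι → ProbabilityMeasure (X × Y)}
    (hopt : ∀ i, IsOptimalPlan (μs i) (νs i) (fun p => (c p : ℝ≥0∞)) (πs i))
    (hfin : ∀ i, transportCost (fun p => (c p : ℝ≥0∞)) (πs i) < ∞)
    {π : ProbabilityMeasure (X × Y)} (hlim : Tendsto πs l (𝓝 π)) :
    IsCyclicallyMonotone c (π : Measure (X × Y)).support := by
  intro n σ w hw
  by_contra! hlt
  let V : Set (Fin n → X × Y) := {v | ∑ i, c ((v (σ i)).1, (v i).2) < ∑ i, c (v i)}
  have hV : IsOpen V := isOpen_lt (by fun_prop) (by fun_prop)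
  obtain ⟨U, hU, hUV⟩ := isOpen_pi_iff'.1 hV w hlt
  have hev : ∀ i, ∀ᶠ k in l, 0 < (πs k : Measure (X × Y)) (U i) := by
    intro i
    have hpos : 0 < (π : Measure (X × Y)) (U i) :=
      (Measure.mem_support_iff_forall _).1 (hw i) _ ((hU i).1.mem_nhds (hU i).2)
    exact eventually_lt_of_lt_liminf
      (hpos.trans_le (ProbabilityMeasure.le_liminf_measure_open_of_tendsto hlim (hU i).1))
  obtain ⟨k, hk⟩ := (eventually_all.2 hev).exists
  obtain ⟨i, hi⟩ := (hopt k).exists_measure_eq_zero (by fun_prop) (hfin k) σ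
    (fun i => (hU i).1.measurableSet) fun v hv => by
      have : v ∈ V := hUV fun i _ => hv i
      exact_mod_cast this
  exact (hk i).ne' hi

theorem mem_transportPlans_of_tendsto {X Y ι : Type*}
    [TopologicalSpace X] [PolishSpace X] [MeasurableSpace X] [BorelSpace X]
    [TopologicalSpace Y] [PolishSpace Y] [MeasurableSpace Y] [BorelSpace Y]
    {l : Filter ι} [l.NeBot] {μs : ι → ProbabilityMeasure X} {νs : ι → ProbabilityMeasure Y}
    {πs : ι → ProbabilityMeasure (X × Y)} {μ : ProbabilityMeasure X} {ν : ProbabilityMeasure Y}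
    {π : ProbabilityMeasure (X × Y)} (hmem : ∀ i, πs i ∈ transportPlans (μs i) (νs i))
    (hμ : Tendsto μs l (𝓝 μ)) (hν : Tendsto νs l (𝓝 ν)) (hπ : Tendsto πs l (𝓝 π)) :
    π ∈ transportPlans μ ν := by
  have h1 := ProbabilityMeasure.tendsto_map_of_tendsto_of_continuous πs π hπ continuous_fst
  have h2 := ProbabilityMeasure.tendsto_map_of_tendsto_of_continuous πs π hπ continuous_snd
  have e1 : (fun i => (πs i).map (continuous_fst.measurable.aemeasurable (f := Prod.fst))) = μs :=
    funext fun i => Subtype.ext (hmem i).1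
  have e2 : (fun i => (πs i).map (continuous_snd.measurable.aemeasurable (f := Prod.snd))) = νs :=
    funext fun i => Subtype.ext (hmem i).2
  rw [e1] at h1
  rw [e2] at h2
  exact ⟨congrArg (fun ρ : ProbabilityMeasure X => (ρ : Measure X)) (tendsto_nhds_unique h1 hμ),
    congrArg (fun ρ : ProbabilityMeasure Y => (ρ : Measure Y)) (tendsto_nhds_unique h2 hν)⟩

theorem isOptimalPlan_of_tendsto {X Y ι : Type*}
    [TopologicalSpace X] [PolishSpace X] [MeasurableSpace X] [BorelSpace X]
    [TopologicalSpace Y] [PolishSpace Y] [MeasurableSpace Y] [BorelSpace Y]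
    {c : X × Y → ℝ≥0} (hc : Continuous c) {l : Filter ι} [l.NeBot]
    {μs : ι → ProbabilityMeasure X} {νs : ι → ProbabilityMeasure Y}
    {πs : ι → ProbabilityMeasure (X × Y)} {μ : ProbabilityMeasure X} {ν : ProbabilityMeasure Y}
    {π : ProbabilityMeasure (X × Y)}
    (hopt : ∀ i, IsOptimalPlan (μs i) (νs i) (fun p => (c p : ℝ≥0∞)) (πs i))
    (hfin : ∀ i, transportCost (fun p => (c p : ℝ≥0∞)) (πs i) < ∞)
    (hμ : Tendsto μs l (𝓝 μ)) (hν : Tendsto νs l (𝓝 ν)) (hπ : Tendsto πs l (𝓝 π)) :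
    IsOptimalPlan μ ν (fun p => (c p : ℝ≥0∞)) π := by
  have hmem := mem_transportPlans_of_tendsto (fun i => (hopt i).1) hμ hν hπ
  have hcm := IsOptimalPlan.isCyclicallyMonotone_support_of_tendsto hc hopt hfin hπ
  obtain ⟨φ, ψ, hφ, hψ, hle, heq⟩ :=
    hcm.exists_potentials hc (Measure.nonempty_support (IsProbabilityMeasure.ne_zero _))
  refine ⟨hmem, fun π' hπ' => transportCost_le_of_potentials hφ hψ hle hmem hπ' ?_⟩
  filter_upwards [Measure.support_mem_ae] with p hp using heq p hp

theorem isTightMeasureSet_range_of_tendsto {X : Type*}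
    [TopologicalSpace X] [PolishSpace X] [MeasurableSpace X] [BorelSpace X]
    {μs : ℕ → ProbabilityMeasure X} {μ : ProbabilityMeasure X} (h : Tendsto μs atTop (𝓝 μ)) :
    IsTightMeasureSet {((ρ : ProbabilityMeasure X) : Measure X) | ρ ∈ Set.range μs} := by
  -- The converse half of Prokhorov's theorem is stated for a complete metric.
  let _ := TopologicalSpace.upgradeIsCompletelyMetrizable X
  exact isTightMeasureSet_of_isCompact_closure
    (h.isCompact_insert_range.closure_of_subset (Set.subset_insert _ _))

/-- Prokhorov's theorem for transport plans: weak convergence of the marginals makes the plans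
tight. -/
theorem exists_subseq_tendsto_of_tendsto_marginals {X Y : Type*}
    [TopologicalSpace X] [PolishSpace X] [MeasurableSpace X] [BorelSpace X]
    [TopologicalSpace Y] [PolishSpace Y] [MeasurableSpace Y] [BorelSpace Y]
    {μs : ℕ → ProbabilityMeasure X} {νs : ℕ → ProbabilityMeasure Y}
    {πs : ℕ → ProbabilityMeasure (X × Y)} {μ : ProbabilityMeasure X} {ν : ProbabilityMeasure Y}
    (hmem : ∀ i, πs i ∈ transportPlans (μs i) (νs i))
    (hμ : Tendsto μs atTop (𝓝 μ)) (hν : Tendsto νs atTop (𝓝 ν)) :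
    ∃ (π : ProbabilityMeasure (X × Y)) (k : ℕ → ℕ), StrictMono k ∧
      Tendsto (πs ∘ k) atTop (𝓝 π) := by
  have htight : IsTightMeasureSet
      {((ρ : ProbabilityMeasure (X × Y)) : Measure (X × Y)) | ρ ∈ Set.range πs} := by
    refine .prodMk ((isTightMeasureSet_range_of_tendsto hμ).subset ?_)
      ((isTightMeasureSet_range_of_tendsto hν).subset ?_)
    · rintro _ ⟨_, ⟨_, ⟨i, rfl⟩, rfl⟩, rfl⟩
      exact ⟨μs i, ⟨i, rfl⟩, (hmem i).1.symm⟩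
    · rintro _ ⟨_, ⟨_, ⟨i, rfl⟩, rfl⟩, rfl⟩
      exact ⟨νs i, ⟨i, rfl⟩, (hmem i).2.symm⟩
  obtain ⟨π, -, k, hk, hlim⟩ := (isCompact_closure_of_isTightMeasureSet htight).tendsto_subseq
    fun n => subset_closure ⟨n, rfl⟩
  exact ⟨π, k, hk, hlim⟩


/-- For a finite continuous cost, an approximating sequence of optimizers has a subsequence that
converges weakly to an optimizer of the limit problem; every convergent subsequence converges to an
optimizer; and the set of adherence points is a non-empty set of optimizers. -/
theorem mainTheorem5 {X Y : Type*}
    [TopologicalSpace X] [PolishSpace X] [MeasurableSpace X] [BorelSpace X]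
    [TopologicalSpace Y] [PolishSpace Y] [MeasurableSpace Y] [BorelSpace Y]
    (c : X × Y → ℝ≥0) (hc : Continuous c)
    (μ : ProbabilityMeasure X) (ν : ProbabilityMeasure Y)
    (μs : ℕ → ProbabilityMeasure X) (νs : ℕ → ProbabilityMeasure Y)
    (πs : ℕ → ProbabilityMeasure (X × Y))
    (h : IsApproximatingSequence μ ν (fun p => (c p : ℝ≥0∞)) μs νs πs) :
    (∃ (k : ℕ → ℕ) (π : ProbabilityMeasure (X × Y)), StrictMono k ∧
        Tendsto (fun j => πs (k j)) atTop (𝓝 π) ∧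
        IsOptimalPlan μ ν (fun p => (c p : ℝ≥0∞)) π) ∧
      (∀ (k : ℕ → ℕ) (π : ProbabilityMeasure (X × Y)), StrictMono k →
        Tendsto (fun j => πs (k j)) atTop (𝓝 π) →
        IsOptimalPlan μ ν (fun p => (c p : ℝ≥0∞)) π) ∧
      {π : ProbabilityMeasure (X × Y) | MapClusterPt π atTop πs}.Nonempty ∧
      {π : ProbabilityMeasure (X × Y) | MapClusterPt π atTop πs} ⊆
        {π : ProbabilityMeasure (X × Y) | IsOptimalPlan μ ν (fun p => (c p : ℝ≥0∞)) π} := by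

  have hlimit : ∀ (k : ℕ → ℕ) (π : ProbabilityMeasure (X × Y)), StrictMono k →
      Tendsto (fun j => πs (k j)) atTop (𝓝 π) →
      IsOptimalPlan μ ν (fun p => (c p : ℝ≥0∞)) π := fun k π hk hπ =>
    isOptimalPlan_of_tendsto hc (fun j => h.optimal (k j)) (fun j => h.cost_lt_top (k j))
      (h.tendsto_fst.comp hk.tendsto_atTop) (h.tendsto_snd.comp hk.tendsto_atTop) hπ
  obtain ⟨π, k, hk, hπ⟩ := exists_subseq_tendsto_of_tendsto_marginals
    (fun n => (h.optimal n).1) h.tendsto_fst h.tendsto_snd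
  refine ⟨⟨k, π, hk, hπ, hlimit k π hk hπ⟩, hlimit, ⟨π, ?_⟩, fun π' hπ' => ?_⟩
  · exact MapClusterPt.of_comp hk.tendsto_atTop hπ.mapClusterPt
  · obtain ⟨k', hk', hlim⟩ := MapClusterPt.tendsto_subseq hπ'
    exact hlimit k' π' hk' hlim
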